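/- Let $\Omega\subset\mathbb{R}^n$ be an open set of finite Lebesgue measure and let $p:\Omega\to[1,\infty]$ be measurable with $p_+=\operatorname{ess\,sup}_{\Omega}p<\infty$. Let $L^{p(\cdot)}(\Omega)$ be the space of measurable $f:\Omega\to\mathbb{R}$ with $\rho_\lambda(f)<\infty$ for some $\lambda>0$, where $$\rho_\lambda(f)=\int_{\{p<\infty\}}\Big(\frac{|f(x)|}{\lambda}\Big)^{p(x)}dx+\lambda^{-1}\|f\|_{L^\infty(\{p=\infty\})},$$ with norm $\|f\|_{p(\cdot)}=\inf\{\lambda>0:\rho_\lambda(f)\le 1\}$. For $a>0$ let $L(\log L)^a(\Omega)$ be the Orlicz space of the Young function $M_a(t)=t(\log(e+t))^a$, that is, the space of measurable $f$ with $\int_\Omega M_a(|f|/\lambda)\,dx<\infty$ for some $\lambda>0$, with norm $\inf\{\lambda>0:\int_\Omega M_a(|f|/\lambda)\,dx\le 1\}$. For $x\in\Omega$ let $Mf(x)=\sup_{B\ni x}\frac{1}{|B|}\int_{B\cap\Omega}|f(y)|\,dy$, the supremum being over all balls $B\subset\mathbb{R}^n$ containing $x$. Let $a>0$, $b\in\mathbb{R}$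 and, for small $r>0$, put $$\Lambda(r,a,b)=1+\frac{a\ln\ln(1/r)}{\ln(1/r)}+\frac{b}{\ln(1/r)}.$$ Suppose that there is a constant $C>1$ such that, for all sufficiently small $\lambda>0$, $$|\{x\in\Omega:\ p(x)\le\Lambda(\lambda,a,b)\}|\le C\lambda .$$ Then $L^{p(\cdot)}(\Omega)\subset L(\log L)^a(\Omega)$, and this embedding is bounded: there is a constant $K$ with $\|f\|_{L(\log L)^a(\Omega)}\le K\|f\|_{p(\cdot)}$ for all $f\in L^{p(\cdot)}(\Omega)$. If in addition $a=1$, then there is a constant $K$ such that $$\|Mf\|_{L^1(\Omega)}\le K\|f\|_{p(\cdot)}\qquad\text{for all } f\in L^{p(\cdot)}(\Omega).$$ -/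

import Mathlib

open MeasureTheory Set Filter Topology
open scoped ENNReal NNReal

noncomputable section

/-- The class of exponents on `Ω`: (Lebesgue) measurable functions on `Ω` with values in
`[1, ∞]`.  Functions on `Ω` are represented by functions on the whole space; only their
values on `Ω` matter. -/
def IsExponent {n : ℕ} (Ω : Set (EuclideanSpace ℝ (Fin n)))
    (p : EuclideanSpace ℝ (Fin n) → ℝ≥0∞) : Prop :=
  AEMeasurable p (volume.restrict Ω) ∧ ∀ x ∈ Ω, 1 ≤ p x

/-- The essential supremum of the exponent over `Ω`. -/
def exponentSup {n : ℕ} (Ω : Set (EuclideanSpace ℝ (Fin n)))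
    (p : EuclideanSpace ℝ (Fin n) → ℝ≥0∞) : ℝ≥0∞ :=
  essSup p (volume.restrict Ω)

/-- The modular `∫_{p < ∞} (|f| / c) ^ p(x) dx + c⁻¹ * ‖f‖_{L^∞(p = ∞)}`, for `c > 0`. -/
def variableModular {n : ℕ} (Ω : Set (EuclideanSpace ℝ (Fin n)))
    (p : EuclideanSpace ℝ (Fin n) → ℝ≥0∞) (c : ℝ) (f : EuclideanSpace ℝ (Fin n) → ℝ) : ℝ≥0∞ :=
  (∫⁻ x in {x ∈ Ω | p x ≠ ∞}, ENNReal.ofReal ((|f x| / c) ^ (p x).toReal)) +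
    (ENNReal.ofReal c)⁻¹ * eLpNorm f ∞ (volume.restrict {x ∈ Ω | p x = ∞})

/-- The variable Lebesgue space with exponent `p` on `Ω`. -/
def variableLebesgue {n : ℕ} (Ω : Set (EuclideanSpace ℝ (Fin n)))
    (p : EuclideanSpace ℝ (Fin n) → ℝ≥0∞) : Set (EuclideanSpace ℝ (Fin n) → ℝ) :=
  {f | AEStronglyMeasurable f (volume.restrict Ω) ∧ ∃ c : ℝ, 0 < c ∧ variableModular Ω p c f < ∞}

/-- The Luxemburg norm of the variable Lebesgue space (infinite if no `c` is admissible). -/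
def variableNorm {n : ℕ} (Ω : Set (EuclideanSpace ℝ (Fin n)))
    (p : EuclideanSpace ℝ (Fin n) → ℝ≥0∞) (f : EuclideanSpace ℝ (Fin n) → ℝ) : ℝ≥0∞ :=
  ⨅ (c : ℝ) (_ : 0 < c) (_ : variableModular Ω p c f ≤ 1), ENNReal.ofReal c

/-- The Orlicz space on `Ω` generated by the function `M`. -/
def orliczSpace {n : ℕ} (M : ℝ → ℝ) (Ω : Set (EuclideanSpace ℝ (Fin n))) :
    Set (EuclideanSpace ℝ (Fin n) → ℝ) :=
  {f | AEStronglyMeasurable f (volume.restrict Ω) ∧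
    ∃ c : ℝ, 0 < c ∧ ∫⁻ x in Ω, ENNReal.ofReal (M (|f x| / c)) < ∞}

/-- The Luxemburg norm of the Orlicz space (infinite if no `c` is admissible). -/
def orliczNorm {n : ℕ} (M : ℝ → ℝ) (Ω : Set (EuclideanSpace ℝ (Fin n)))
    (f : EuclideanSpace ℝ (Fin n) → ℝ) : ℝ≥0∞ :=
  ⨅ (c : ℝ) (_ : 0 < c) (_ : ∫⁻ x in Ω, ENNReal.ofReal (M (|f x| / c)) ≤ 1), ENNReal.ofReal c

/-- The Young function `t * (log (e + t)) ^ α`; its Orlicz space is `L (log L) ^ α`. -/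
def zygmundYoung (α t : ℝ) : ℝ :=
  t * Real.log (Real.exp 1 + t) ^ α

/-- The function `1 + a * ln ln (1/r) / ln (1/r) + b / ln (1/r)`, meaningful for small `r > 0`. -/
def lambdaFun (r a b : ℝ) : ℝ :=
  1 + a * Real.log (Real.log (1 / r)) / Real.log (1 / r) + b / Real.log (1 / r)

/-- The uncentered Hardy-Littlewood maximal function on `Ω`: the supremum of
`|B|⁻¹ * ∫_{B ∩ Ω} |f|` over all balls `B` of the whole space that contain `x`. -/
def maximalFunction {n : ℕ} (Ω : Set (EuclideanSpace ℝ (Fin n)))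
    (f : EuclideanSpace ℝ (Fin n) → ℝ) (x : EuclideanSpace ℝ (Fin n)) : ℝ≥0∞ :=
  ⨆ (z : EuclideanSpace ℝ (Fin n)) (r : ℝ) (_ : x ∈ Metric.ball z r),
    (volume (Metric.ball z r))⁻¹ * ∫⁻ y in Metric.ball z r ∩ Ω, ‖f y‖ₑ

end

/-!
Write `L = ln (1/r)`, so that `Λ = lambdaFun (exp (-L)) a b = 1 + (a ln L + b) / L`. This choice
makes `t ^ (Λ - 1)` equal to `e ^ b * (ln t) ^ a` at `t = exp L`. By comparing the logarithm with
its tangent line at `L`, for large `L` the inequality `t * (log (e + t)) ^ a ≤ B * t ^ q` holds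
for all `q ≥ Λ`, not only for `t ≥ exp L` but already for `t ≥ exp L / L ^ (a + 2)`
(`zygmundYoung_le_mul_rpow`). For smaller `t` the left side is at most a constant times
`exp L / L ^ 2` (`zygmundYoung_le_exp_div_sq`). The gain of the power of `L` is what matters: the
set where the exponent is at most `lambdaFun (exp (-k)) a b` has measure at most `C * exp (-k)`, so
that these bounds, with `L = k + 1` on the layer where the exponent lies between two consecutive
values, contribute a multiple of the convergent series `∑ 1 / k ^ 2`. Summing over the layers gives
`∫ M_a(g) ≤ A + B * ∫ g ^ p` (`exists_lintegral_zygmundYoung_le`), and the embedding follows from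
`M_a(t / K) ≤ M_a(t) / K` for `K ≥ 1`. The set `p = ∞` plays no role, being null because the
essential supremum of `p` is finite.

For the maximal function, Vitali's covering lemma gives the weak type estimate
`s * |{Mf > 2 s}| ≤ 5 ^ n * ∫_{|f| > s} |f|` (`mul_volume_setOf_lt_maximalFunction_le`). Since
`Mf ≤ 1 + ∑ 2 ^ k` over the `k` with `2 ^ k < Mf`, summing over `s = 2 ^ (k - 1)` bounds the
integral of `Mf` by `|Ω|` plus a multiple of the integral of `|f| * log (e + |f|)`
(`lintegral_maximalFunction_le`), to which the first part applies.
-/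

/-! ### Pointwise comparison of the Young function with powers -/

lemma lambdaFun_exp_neg (L a b : ℝ) :
    lambdaFun (Real.exp (-L)) a b = 1 + (a * Real.log L + b) / L := by
  have h : Real.log (1 / Real.exp (-L)) = L := by
    rw [one_div, ← Real.exp_neg, neg_neg, Real.log_exp]
  rw [lambdaFun, h]
  ring

lemma tendsto_lambdaFun_exp_neg (a b : ℝ) :
    Tendsto (fun L : ℝ => lambdaFun (Real.exp (-L)) a b) atTop (𝓝 1) := by
  have h1 : Tendsto (fun L : ℝ => Real.log L / L) atTop (𝓝 0) := by
    simpa using Real.tendsto_pow_log_div_mul_add_atTop 1 0 1 one_ne_zero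
  have h2 : Tendsto (fun L : ℝ => b / L) atTop (𝓝 0) := tendsto_id.const_div_atTop b
  have h3 := (tendsto_const_nhds (x := (1 : ℝ))).add ((h1.const_mul a).add h2)
  simp only [mul_zero, add_zero] at h3
  refine h3.congr fun L => ?_
  rw [lambdaFun_exp_neg]
  ring

lemma eventually_one_le_lambdaFun_exp_neg {a : ℝ} (ha : 0 < a) (b : ℝ) :
    ∀ᶠ L : ℝ in atTop, 1 ≤ lambdaFun (Real.exp (-L)) a b := by
  have h : Tendsto (fun L : ℝ => a * Real.log L + b) atTop atTop :=
    tendsto_atTop_add_const_right _ _ (Real.tendsto_log_atTop.const_mul_atTop ha)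
  filter_upwards [h.eventually_ge_atTop 0, eventually_gt_atTop 0] with L h0 hL
  rw [lambdaFun_exp_neg]
  have := div_nonneg h0 hL.le
  linarith

lemma one_le_log_exp_add {t : ℝ} (ht : 0 ≤ t) : 1 ≤ Real.log (Real.exp 1 + t) := by
  rw [Real.le_log_iff_exp_le (by positivity)]
  linarith

lemma log_exp_add_le {t s : ℝ} (ht : 0 ≤ t) (hs : 1 ≤ s) (hts : t ≤ Real.exp s) :
    Real.log (Real.exp 1 + t) ≤ 2 * s := by
  rw [Real.log_le_iff_le_exp (by positivity)]
  have h1 : Real.exp 1 ≤ Real.exp s := Real.exp_le_exp.2 hs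
  have h2 : 2 ≤ Real.exp s := by
    have := Real.add_one_le_exp s
    linarith
  rw [two_mul, Real.exp_add]
  nlinarith

/-- Domination by the power `t ^ q` for large `t`. The threshold lies below `exp L` by the factor
`L ^ (a + 2)`; the loss this causes in the exponent is of order `(log L) ^ 2 / L`, which `h2`
keeps at most `1`. -/
lemma zygmundYoung_le_mul_rpow {a b L t q : ℝ} (ha : 0 < a) (hL : 1 ≤ L)
    (h1 : a ≤ a * Real.log L + b)
    (h2 : (a + 2) * Real.log L * (a * Real.log L + b - a) ≤ L)
    (h3 : 1 ≤ L - (a + 2) * Real.log L)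
    (hq : lambdaFun (Real.exp (-L)) a b ≤ q)
    (ht : Real.exp (L - (a + 2) * Real.log L) ≤ t) :
    zygmundYoung a t ≤ 2 ^ a * Real.exp (1 - b) * t ^ q := by
  have hL0 : 0 < L := by linarith
  have ht0 : 0 < t := (Real.exp_pos _).trans_le ht
  obtain ⟨s, rfl⟩ : ∃ s, t = Real.exp s := ⟨Real.log t, (Real.exp_log ht0).symm⟩
  rw [Real.exp_le_exp] at ht
  have hs1 : 1 ≤ s := h3.trans ht
  have hs0 : 0 < s := by linarith
  -- the tangent line of the logarithm at `L`
  have hlog : Real.log s ≤ Real.log L + (s / L - 1) := by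
    have := Real.log_le_sub_one_of_pos (div_pos hs0 hL0)
    rw [Real.log_div hs0.ne' hL0.ne'] at this
    linarith
  have hy : -1 ≤ (s / L - 1) * (a * Real.log L + b - a) := by
    have e : (s / L - 1) * (a * Real.log L + b - a)
        = (s - L) * (a * Real.log L + b - a) / L := by
      field_simp
    rw [e, le_div_iff₀ hL0]
    nlinarith [mul_le_mul_of_nonneg_right (show -((a + 2) * Real.log L) ≤ s - L by linarith)
      (sub_nonneg.2 h1)]
  have key : a * Real.log s ≤ s * (q - 1) + (1 - b) := by
    have e1 : (a * Real.log L + b) / L ≤ q - 1 := by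
      rw [lambdaFun_exp_neg] at hq
      linarith
    have e2 : s * ((a * Real.log L + b) / L) ≤ s * (q - 1) := mul_le_mul_of_nonneg_left e1 hs0.le
    have e3 : s * ((a * Real.log L + b) / L) = (s / L - 1) * (a * Real.log L + b - a)
        + (a * Real.log L + b) + a * (s / L - 1) := by
      field_simp
      ring
    nlinarith [mul_le_mul_of_nonneg_left hlog ha.le]
  calc zygmundYoung a (Real.exp s)
      ≤ Real.exp s * (2 * s) ^ a := by
        refine mul_le_mul_of_nonneg_left (Real.rpow_le_rpow ?_ ?_ ha.le) (Real.exp_pos s).le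
        · exact zero_le_one.trans (one_le_log_exp_add (Real.exp_pos s).le)
        · exact log_exp_add_le (Real.exp_pos s).le hs1 le_rfl
    _ = 2 ^ a * Real.exp (s + a * Real.log s) := by
        rw [Real.mul_rpow zero_le_two hs0.le, Real.exp_add, Real.rpow_def_of_pos hs0,
          mul_comm (Real.log s) a]
        ring
    _ ≤ 2 ^ a * Real.exp ((1 - b) + s * q) := by
        refine mul_le_mul_of_nonneg_left (Real.exp_le_exp.2 ?_) (by positivity)
        linarith
    _ = 2 ^ a * Real.exp (1 - b) * Real.exp s ^ q := by
        rw [Real.exp_add, ← Real.exp_mul]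
        ring

/-- The bound below the threshold: the factor `L ^ (-(a + 2))` absorbs the logarithmic factor
`(2 * L) ^ a` and leaves the summable weight `L ^ (-2)`. -/
lemma zygmundYoung_le_exp_div_sq {a L t : ℝ} (ha : 0 < a) (hL : 1 ≤ L) (ht0 : 0 ≤ t)
    (ht : t ≤ Real.exp (L - (a + 2) * Real.log L)) :
    zygmundYoung a t ≤ 2 ^ a * (Real.exp L / L ^ 2) := by
  have hL0 : 0 < L := by linarith
  have hlogL : 0 ≤ Real.log L := Real.log_nonneg hL
  have htL : t ≤ Real.exp L := ht.trans (Real.exp_le_exp.2 (by nlinarith))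
  have e : Real.exp (L - (a + 2) * Real.log L) = Real.exp L / (L ^ a * L ^ 2) := by
    rw [Real.exp_sub, ← Real.rpow_natCast L 2, ← Real.rpow_add hL0, Real.rpow_def_of_pos hL0,
      mul_comm (Real.log L)]
    norm_num
  calc zygmundYoung a t
      ≤ Real.exp (L - (a + 2) * Real.log L) * (2 * L) ^ a := by
        refine mul_le_mul ht (Real.rpow_le_rpow ?_ ?_ ha.le) ?_ (Real.exp_pos _).le
        · exact zero_le_one.trans (one_le_log_exp_add ht0)
        · exact log_exp_add_le ht0 hL htL
        · exact Real.rpow_nonneg (zero_le_one.trans (one_le_log_exp_add ht0)) _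
    _ = 2 ^ a * (Real.exp L / L ^ 2) := by
        have : L ^ a ≠ 0 := (Real.rpow_pos_of_pos hL0 a).ne'
        rw [e, Real.mul_rpow zero_le_two hL0.le]
        field_simp

lemma eventually_zygmundYoung_le {a : ℝ} (ha : 0 < a) (b : ℝ) :
    ∀ᶠ L : ℝ in atTop, ∀ q t : ℝ, lambdaFun (Real.exp (-L)) a b ≤ q → 0 ≤ t →
      zygmundYoung a t ≤ 2 ^ a * Real.exp (1 - b) * t ^ q + 2 ^ a * (Real.exp L / L ^ 2) := by
  have g1 : Tendsto (fun L : ℝ => a * Real.log L + b) atTop atTop :=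
    tendsto_atTop_add_const_right _ _ (Real.tendsto_log_atTop.const_mul_atTop ha)
  have l1 : Tendsto (fun L : ℝ => Real.log L ^ 1 / (1 * L + 0)) atTop (𝓝 0) :=
    Real.tendsto_pow_log_div_mul_add_atTop 1 0 1 one_ne_zero
  have l2 : Tendsto (fun L : ℝ => Real.log L ^ 2 / (1 * L + 0)) atTop (𝓝 0) :=
    Real.tendsto_pow_log_div_mul_add_atTop 1 0 2 one_ne_zero
  have g2 : Tendsto (fun L : ℝ => (a + 2) * a * (Real.log L ^ 2 / (1 * L + 0))
      + (a + 2) * (b - a) * (Real.log L ^ 1 / (1 * L + 0))) atTop (𝓝 0) := by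
    simpa using (l2.const_mul ((a + 2) * a)).add (l1.const_mul ((a + 2) * (b - a)))
  have g3 : Tendsto (fun L : ℝ => (a + 2) * (Real.log L ^ 1 / (1 * L + 0))) atTop (𝓝 0) := by
    simpa using l1.const_mul (a + 2)
  filter_upwards [g1.eventually_ge_atTop a, g2.eventually_le_const zero_lt_one,
    g3.eventually_le_const (show (0 : ℝ) < 1 / 2 by norm_num), eventually_ge_atTop 2]
    with L h1 h2 h3 hL q t hq ht
  have hL0 : 0 < L := by linarith
  have h2' : (a + 2) * Real.log L * (a * Real.log L + b - a) ≤ L := by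
    have e : (a + 2) * a * (Real.log L ^ 2 / (1 * L + 0))
        + (a + 2) * (b - a) * (Real.log L ^ 1 / (1 * L + 0))
        = (a + 2) * Real.log L * (a * Real.log L + b - a) / L := by
      field_simp
      ring
    rw [e, div_le_one hL0] at h2
    exact h2
  have h3' : 1 ≤ L - (a + 2) * Real.log L := by
    have e : (a + 2) * (Real.log L ^ 1 / (1 * L + 0)) = (a + 2) * Real.log L / L := by
      field_simp
      ring
    rw [e, div_le_iff₀ hL0] at h3
    linarith
  rcases le_total (Real.exp (L - (a + 2) * Real.log L)) t with h | h
  · have := zygmundYoung_le_mul_rpow ha (by linarith) h1 h2' h3' hq h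
    have : 0 ≤ 2 ^ a * (Real.exp L / L ^ 2) := by positivity
    linarith
  · have := zygmundYoung_le_exp_div_sq ha (by linarith) ht h
    have : 0 ≤ 2 ^ a * Real.exp (1 - b) * t ^ q := by positivity
    linarith

lemma zygmundYoung_div_le {a K t : ℝ} (ha : 0 < a) (hK : 1 ≤ K) (ht : 0 ≤ t) :
    zygmundYoung a (t / K) ≤ zygmundYoung a t / K := by
  have hK0 : 0 < K := by linarith
  have h0 : 0 ≤ t / K := by positivity
  rw [zygmundYoung, zygmundYoung, mul_div_right_comm]
  refine mul_le_mul_of_nonneg_left (Real.rpow_le_rpow ?_ ?_ ha.le) h0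
  · exact zero_le_one.trans (one_le_log_exp_add h0)
  · exact Real.log_le_log (by positivity) (by gcongr; exact div_le_self ht hK)

/-! ### The modular estimate -/

/-- The set `p ≤ 1` is null, since it lies in all the sets of the distributional hypothesis with
small `r`. -/
lemma ae_one_lt_of_measure_le {X : Type*} [MeasurableSpace X] {μ : Measure X}
    {p : X → ℝ≥0∞} {a b C : ℝ} (ha : 0 < a)
    (hdist : ∀ᶠ r : ℝ in 𝓝[>] 0,
      μ {x | p x ≤ ENNReal.ofReal (lambdaFun r a b)} ≤ ENNReal.ofReal (C * r)) :
    ∀ᵐ x ∂μ, 1 < p x := by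
  have hexp : Tendsto (fun L : ℝ => Real.exp (-L)) atTop (𝓝[>] 0) :=
    tendsto_nhdsWithin_iff.2 ⟨Real.tendsto_exp_neg_atTop_nhds_zero,
      Eventually.of_forall fun L => Real.exp_pos _⟩
  have hlim : Tendsto (fun L : ℝ => ENNReal.ofReal (C * Real.exp (-L))) atTop (𝓝 0) := by
    have := ENNReal.tendsto_ofReal (Real.tendsto_exp_neg_atTop_nhds_zero.const_mul C)
    simpa using this
  have h0 : μ {x | p x ≤ 1} ≤ 0 := by
    refine ge_of_tendsto hlim ?_
    filter_upwards [hexp.eventually hdist, eventually_one_le_lambdaFun_exp_neg ha b] with L h1 h2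
    refine le_trans (measure_mono fun x (hx : p x ≤ 1) => ?_) h1
    exact hx.trans (ENNReal.one_le_ofReal.2 h2)
  rw [ae_iff]
  simpa using h0

/-- The modular estimate behind the embedding, on an arbitrary finite measure space. The parameter
`L` in `eventually_zygmundYoung_le` is chosen pointwise as the first natural number
(from some point on) with `lambdaFun (exp (-L)) a b ≤ p x`. -/
lemma exists_lintegral_zygmundYoung_le {X : Type*} [MeasurableSpace X] {μ : Measure X}
    [IsFiniteMeasure μ] {p : X → ℝ≥0∞} (hp : AEMeasurable p μ) (hpt : ∀ᵐ x ∂μ, p x ≠ ∞)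
    {a b C : ℝ} (ha : 0 < a)
    (hdist : ∀ᶠ r : ℝ in 𝓝[>] 0,
      μ {x | p x ≤ ENNReal.ofReal (lambdaFun r a b)} ≤ ENNReal.ofReal (C * r)) :
    ∃ A B : ℝ≥0, ∀ g : X → ℝ, (∀ x, 0 ≤ g x) →
      ∫⁻ x, ENNReal.ofReal (zygmundYoung a (g x)) ∂μ
        ≤ A + B * ∫⁻ x, ENNReal.ofReal (g x ^ (p x).toReal) ∂μ := by
  have hexp : Tendsto (fun L : ℝ => Real.exp (-L)) atTop (𝓝[>] 0) :=
    tendsto_nhdsWithin_iff.2 ⟨Real.tendsto_exp_neg_atTop_nhds_zero,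
      Eventually.of_forall fun L => Real.exp_pos _⟩
  obtain ⟨N, hN⟩ := eventually_atTop.1 <| tendsto_natCast_atTop_atTop.eventually <|
    (hexp.eventually hdist).and (eventually_zygmundYoung_le ha b)
  set lam : ℕ → ℝ := fun k => lambdaFun (Real.exp (-((N + k : ℕ) : ℝ))) a b with hlam
  set w : ℕ → ℝ := fun k => 2 ^ a * (Real.exp ((N + k : ℕ) : ℝ) / ((N + k : ℕ) : ℝ) ^ 2) with hw
  set E : ℕ → Set X := fun k => {x | p x ≤ ENNReal.ofReal (lam k)} with hE
  have hlim : Tendsto lam atTop (𝓝 1) :=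
    (tendsto_lambdaFun_exp_neg a b).comp <| tendsto_natCast_atTop_atTop.comp <|
      tendsto_atTop_mono (fun k => Nat.le_add_left k N) tendsto_id
  have hw0 : ∀ k, 0 ≤ w k := fun k => by positivity
  -- On the layer where `lam k` is the first value at most `p x`, the pointwise bound leaves the
  -- remainder `w k`; for `k ≥ 1` this layer lies in `E (k - 1)`, whence the shift by one.
  set h : X → ℝ≥0∞ := fun x =>
    ENNReal.ofReal (w 0) + ∑' k, (E k).indicator (fun _ => ENNReal.ofReal (w (k + 1))) x with hh
  have hEm : ∀ k, NullMeasurableSet (E k) μ := fun k => nullMeasurableSet_le hp aemeasurable_const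
  have hterm : ∀ k, AEMeasurable ((E k).indicator fun _ => ENNReal.ofReal (w (k + 1))) μ :=
    fun k => aemeasurable_const.indicator₀ (hEm k)
  have hhm : AEMeasurable h μ := aemeasurable_const.add (AEMeasurable.tsum hterm)
  have hhfin : ∫⁻ x, h x ∂μ ≠ ∞ := by
    rw [hh, lintegral_add_left measurable_const, lintegral_tsum hterm, lintegral_const]
    refine ENNReal.add_ne_top.2 ⟨ENNReal.mul_ne_top ENNReal.ofReal_ne_top (measure_ne_top _ _), ?_⟩
    have hle : ∀ k, ∫⁻ x, (E k).indicator (fun _ => ENNReal.ofReal (w (k + 1))) x ∂μ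
        ≤ ENNReal.ofReal (2 ^ a * C * Real.exp 1 * (1 / ((N + 1 + k : ℕ) : ℝ) ^ 2)) := fun k => by
      rw [lintegral_indicator_const₀ (hEm k)]
      refine (mul_le_mul_right (hN (N + k) (Nat.le_add_right _ _)).1 _).trans (le_of_eq ?_)
      rw [← ENNReal.ofReal_mul (hw0 _)]
      congr 1
      have e1 : ((N + (k + 1) : ℕ) : ℝ) = ((N + k : ℕ) : ℝ) + 1 := by push_cast; ring
      have e2 : ((N + 1 + k : ℕ) : ℝ) = ((N + k : ℕ) : ℝ) + 1 := by push_cast; ring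
      simp only [hw]
      rw [e1, e2, Real.exp_add, Real.exp_neg]
      have := (Real.exp_pos ((N + k : ℕ) : ℝ)).ne'
      field_simp
    refine ne_top_of_le_ne_top ?_ (ENNReal.tsum_le_tsum hle)
    refine Summable.tsum_ofReal_ne_top (Summable.mul_left _ ?_)
    have hs : Summable fun k : ℕ => 1 / (k : ℝ) ^ 2 := Real.summable_one_div_nat_pow.2 one_lt_two
    simpa only [Nat.add_comm] using (summable_nat_add_iff (N + 1)).2 hs
  set B : ℝ := 2 ^ a * Real.exp (1 - b) with hB
  have hB0 : 0 ≤ B := by positivity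
  refine ⟨(∫⁻ x, h x ∂μ).toNNReal, B.toNNReal, fun g hg => ?_⟩
  have hpoint : ∀ᵐ x ∂μ, ENNReal.ofReal (zygmundYoung a (g x))
      ≤ h x + ENNReal.ofReal B * ENNReal.ofReal (g x ^ (p x).toReal) := by
    filter_upwards [hpt, ae_one_lt_of_measure_le ha hdist] with x hx1 hx2
    have hx2' : 1 < (p x).toReal := by
      rw [← ENNReal.toReal_one]
      exact (ENNReal.toReal_lt_toReal ENNReal.one_ne_top hx1).2 hx2
    have hex : ∃ k, lam k ≤ (p x).toReal := (hlim.eventually_le_const hx2').exists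
    classical
    obtain ⟨k, hk, hmin⟩ : ∃ k, lam k ≤ (p x).toReal ∧ ∀ j < k, (p x).toReal < lam j :=
      ⟨Nat.find hex, Nat.find_spec hex, fun j hj => not_le.1 (Nat.find_min hex hj)⟩
    have hwh : ENNReal.ofReal (w k) ≤ h x := by
      rcases k with _ | k
      · exact le_self_add
      · have hxE : x ∈ E k := by
          change p x ≤ _
          rw [← ENNReal.ofReal_toReal hx1]
          exact ENNReal.ofReal_le_ofReal (hmin k (Nat.lt_succ_self k)).le
        refine le_trans (le_of_eq ?_) ((ENNReal.le_tsum k).trans le_add_self)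
        rw [indicator_of_mem hxE]
    rw [← ENNReal.ofReal_mul hB0, add_comm]
    refine le_trans ?_ (add_le_add_right hwh _)
    rw [← ENNReal.ofReal_add (mul_nonneg hB0 (Real.rpow_nonneg (hg x) _)) (hw0 k)]
    exact ENNReal.ofReal_le_ofReal
      ((hN (N + k) (Nat.le_add_right _ _)).2 _ _ hk (hg x))
  refine (lintegral_mono_ae hpoint).trans ?_
  rw [lintegral_add_left' hhm, lintegral_const_mul' _ _ ENNReal.ofReal_ne_top,
    ENNReal.coe_toNNReal hhfin]
  rfl

/-! ### Luxemburg norms -/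

lemma orliczNorm_le_ofReal {n : ℕ} {Ω : Set (EuclideanSpace ℝ (Fin n))}
    {M : ℝ → ℝ} {f : EuclideanSpace ℝ (Fin n) → ℝ} {c : ℝ} (hc : 0 < c)
    (h : ∫⁻ x in Ω, ENNReal.ofReal (M (|f x| / c)) ≤ 1) :
    orliczNorm M Ω f ≤ ENNReal.ofReal c :=
  iInf_le_of_le c <| iInf_le_of_le hc <| iInf_le_of_le h le_rfl

/-- A bound valid for every admissible `c` passes to the infimum; `K ≠ 0` covers the case in which
no `c` is admissible. -/
lemma le_mul_variableNorm {n : ℕ} {Ω : Set (EuclideanSpace ℝ (Fin n))}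
    {p : EuclideanSpace ℝ (Fin n) → ℝ≥0∞} {f : EuclideanSpace ℝ (Fin n) → ℝ}
    {K : ℝ≥0} (hK : K ≠ 0) {y : ℝ≥0∞}
    (h : ∀ c : ℝ, 0 < c → variableModular Ω p c f ≤ 1 → y ≤ K * ENNReal.ofReal c) :
    y ≤ K * variableNorm Ω p f := by
  have hK' : (K : ℝ≥0∞) ≠ 0 := by exact_mod_cast hK
  rw [← ENNReal.div_le_iff' hK' ENNReal.coe_ne_top]
  refine le_iInf fun c => le_iInf fun hc => le_iInf fun hm => ?_
  rw [ENNReal.div_le_iff' hK' ENNReal.coe_ne_top]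
  exact h c hc hm

lemma exists_lintegral_zygmundYoung_le_variableModular {n : ℕ}
    {Ω : Set (EuclideanSpace ℝ (Fin n))} (hΩ : IsOpen Ω) (hΩfin : volume Ω < ∞)
    {p : EuclideanSpace ℝ (Fin n) → ℝ≥0∞} (hp : IsExponent Ω p) (hpb : exponentSup Ω p < ∞)
    {a b C : ℝ} (ha : 0 < a)
    (hdist : ∀ᶠ r : ℝ in 𝓝[>] 0,
      volume {x ∈ Ω | p x ≤ ENNReal.ofReal (lambdaFun r a b)} ≤ ENNReal.ofReal (C * r)) :
    ∃ A B : ℝ≥0, ∀ (f : EuclideanSpace ℝ (Fin n) → ℝ) (c : ℝ), 0 < c →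
      ∫⁻ x in Ω, ENNReal.ofReal (zygmundYoung a (|f x| / c))
        ≤ A + B * variableModular Ω p c f := by
  have : IsFiniteMeasure (volume.restrict Ω) := ⟨by simpa using hΩfin⟩
  have hpt : ∀ᵐ x ∂volume.restrict Ω, p x ≠ ∞ := by
    filter_upwards [ae_le_essSup (f := p) (μ := volume.restrict Ω)] with x hx
    exact (hx.trans_lt hpb).ne
  have hset : ({x ∈ Ω | p x ≠ ∞} : Set _) =ᵐ[volume] Ω := by
    rw [ae_restrict_iff' hΩ.measurableSet] at hpt
    filter_upwards [hpt] with x hx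
    exact propext ⟨fun h => h.1, fun h => ⟨h, hx h⟩⟩
  obtain ⟨A, B, h⟩ := exists_lintegral_zygmundYoung_le hp.1 hpt (b := b) (C := C) ha (by
    filter_upwards [hdist] with r hr
    rw [Measure.restrict_apply' hΩ.measurableSet, inter_comm]
    exact hr)
  refine ⟨A, B, fun f c hc => (h (fun x => |f x| / c) fun x => by positivity).trans ?_⟩
  refine add_le_add_right (mul_le_mul_right ?_ _) _
  rw [variableModular, Measure.restrict_congr_set hset]
  exact le_self_add

/-- Passage from the modular estimate to the Luxemburg norm: dividing by `1 + A + B` brings the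
modular below `1`. -/
lemma lintegral_zygmundYoung_div_le {n : ℕ}
    {Ω : Set (EuclideanSpace ℝ (Fin n))} {p : EuclideanSpace ℝ (Fin n) → ℝ≥0∞} {a : ℝ} (ha : 0 < a)
    {A B : ℝ≥0} {f : EuclideanSpace ℝ (Fin n) → ℝ} {c : ℝ} (hc : 0 < c)
    (h : ∫⁻ x in Ω, ENNReal.ofReal (zygmundYoung a (|f x| / c))
        ≤ A + B * variableModular Ω p c f) (hm : variableModular Ω p c f ≤ 1) :
    ∫⁻ x in Ω, ENNReal.ofReal (zygmundYoung a (|f x| / ((1 + A + B : ℝ≥0) * c))) ≤ 1 := by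
  set K : ℝ≥0 := 1 + A + B with hK
  have hK1 : (1 : ℝ) ≤ K := by
    have : (1 : ℝ≥0) ≤ K := by rw [hK, add_assoc]; exact le_self_add
    exact_mod_cast this
  have hK0 : (0 : ℝ) < K := by linarith
  calc ∫⁻ x in Ω, ENNReal.ofReal (zygmundYoung a (|f x| / (K * c)))
      ≤ ∫⁻ x in Ω, (K : ℝ≥0∞)⁻¹ * ENNReal.ofReal (zygmundYoung a (|f x| / c)) := by
        refine lintegral_mono fun x => ?_
        have h0 : 0 ≤ |f x| / c := by positivity
        rw [mul_comm (K : ℝ) c, ← div_div, ← ENNReal.ofReal_coe_nnreal,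
          ← ENNReal.ofReal_inv_of_pos hK0, ← ENNReal.ofReal_mul (inv_nonneg.2 hK0.le),
          inv_mul_eq_div]
        exact ENNReal.ofReal_le_ofReal (zygmundYoung_div_le ha hK1 h0)
    _ = (K : ℝ≥0∞)⁻¹ * ∫⁻ x in Ω, ENNReal.ofReal (zygmundYoung a (|f x| / c)) :=
        lintegral_const_mul' _ _ (ENNReal.inv_ne_top.2 (by
          exact_mod_cast (NNReal.coe_pos.1 hK0).ne'))
    _ ≤ (K : ℝ≥0∞)⁻¹ * K := by
        refine mul_le_mul_right (h.trans ?_) _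
        calc (A : ℝ≥0∞) + B * variableModular Ω p c f ≤ A + B * 1 := by gcongr
          _ ≤ 1 + (A + B) := by rw [mul_one]; exact le_add_self
          _ = K := by rw [hK]; push_cast; ring
    _ ≤ 1 := ENNReal.inv_mul_le_one _

/-! ### The maximal function on `L log L` -/

/-- The covering estimate behind the weak type inequality. Compact subsets of the union are covered
by finitely many of the balls, so no bound on the radii is needed for Vitali's lemma. -/
lemma volume_iUnion_ball_le {n : ℕ} {ι : Type*} (z : ι → EuclideanSpace ℝ (Fin n)) (r : ι → ℝ)
    (hr : ∀ i, 0 < r i) {g : EuclideanSpace ℝ (Fin n) → ℝ≥0∞} {t : ℝ≥0∞}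
    (h : ∀ i, t * volume (Metric.ball (z i) (r i)) ≤ ∫⁻ y in Metric.ball (z i) (r i), g y) :
    t * volume (⋃ i, Metric.ball (z i) (r i)) ≤ 5 ^ n * ∫⁻ y, g y := by
  have hopen : IsOpen (⋃ i, Metric.ball (z i) (r i)) := isOpen_iUnion fun i => Metric.isOpen_ball
  rw [hopen.measure_eq_iSup_isCompact]
  simp only [ENNReal.mul_iSup]
  refine iSup_le fun K => iSup_le fun hKU => iSup_le fun hK => ?_
  obtain ⟨s, hs⟩ := hK.elim_finite_subcover _ (fun i => Metric.isOpen_ball) hKU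
  obtain ⟨R, hR⟩ : ∃ R, ∀ i ∈ (s : Set ι), r i ≤ R := by
    obtain ⟨R, hR⟩ := (s.finite_toSet.image r).bddAbove
    exact ⟨R, fun i hi => hR (mem_image_of_mem r hi)⟩
  obtain ⟨u, hus, hdisj, hcov⟩ :=
    Vitali.exists_disjoint_subfamily_covering_enlargement_closedBall (s : Set ι) z r R hR 4
      (by norm_num)
  have hucount : u.Countable := (s.finite_toSet.subset hus).countable
  have hKsub : K ⊆ ⋃ i ∈ u, Metric.ball (z i) (5 * r i) := by
    intro x hx
    obtain ⟨i, hi, hxi⟩ := mem_iUnion₂.1 (hs hx)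
    obtain ⟨j, hj, hij⟩ := hcov i hi
    refine mem_iUnion₂.2 ⟨j, hj, ?_⟩
    have h1 := hij (Metric.ball_subset_closedBall hxi)
    have := hr j
    exact Metric.closedBall_subset_ball (by linarith) h1
  have hvol : ∀ i, volume (Metric.ball (z i) (5 * r i))
      = 5 ^ n * volume (Metric.ball (z i) (r i)) := fun i => by
    rw [Measure.addHaar_ball_mul_of_pos _ _ (by norm_num : (0 : ℝ) < 5),
      Measure.addHaar_ball_center volume (z i), finrank_euclideanSpace_fin,
      ENNReal.ofReal_pow (by norm_num)]
    norm_num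
  calc t * volume K ≤ t * ∑' i : u, volume (Metric.ball (z i) (5 * r i)) := by
        gcongr
        exact (measure_mono hKsub).trans (measure_biUnion_le _ hucount _)
    _ = 5 ^ n * ∑' i : u, t * volume (Metric.ball (z i) (r i)) := by
        simp only [hvol]
        rw [ENNReal.tsum_mul_left, ENNReal.tsum_mul_left]
        ring
    _ ≤ 5 ^ n * ∑' i : u, ∫⁻ y in Metric.ball (z i) (r i), g y := by
        gcongr with i
        exact h i
    _ = 5 ^ n * ∫⁻ y in ⋃ i ∈ u, Metric.ball (z i) (r i), g y := by
        rw [lintegral_biUnion hucount (fun i _ => Metric.isOpen_ball.measurableSet)]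
        exact hdisj.mono_on fun i _ => Metric.ball_subset_closedBall
    _ ≤ 5 ^ n * ∫⁻ y, g y := by
        gcongr
        exact Measure.restrict_le_self

lemma lt_maximalFunction_iff {n : ℕ} {Ω : Set (EuclideanSpace ℝ (Fin n))}
    {f : EuclideanSpace ℝ (Fin n) → ℝ} {t : ℝ≥0∞} {x : EuclideanSpace ℝ (Fin n)} :
    t < maximalFunction Ω f x ↔ ∃ (z : EuclideanSpace ℝ (Fin n)) (r : ℝ), x ∈ Metric.ball z r ∧
      t < (volume (Metric.ball z r))⁻¹ * ∫⁻ y in Metric.ball z r ∩ Ω, ‖f y‖ₑ := by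
  simp only [maximalFunction, lt_iSup_iff, exists_prop]

lemma setOf_lt_maximalFunction_eq {n : ℕ} (Ω : Set (EuclideanSpace ℝ (Fin n)))
    (f : EuclideanSpace ℝ (Fin n) → ℝ) (t : ℝ≥0∞) :
    {x | t < maximalFunction Ω f x} = ⋃ i : {i : EuclideanSpace ℝ (Fin n) × ℝ // 0 < i.2 ∧
      t < (volume (Metric.ball i.1 i.2))⁻¹ * ∫⁻ y in Metric.ball i.1 i.2 ∩ Ω, ‖f y‖ₑ},
        Metric.ball i.1.1 i.1.2 := by
  ext x
  rw [mem_ofPred_eq, lt_maximalFunction_iff, mem_iUnion]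
  constructor
  · rintro ⟨z, r, hx, h⟩
    exact ⟨⟨(z, r), Metric.pos_of_mem_ball hx, h⟩, hx⟩
  · rintro ⟨⟨⟨z, r⟩, hr, h⟩, hx⟩
    exact ⟨z, r, hx, h⟩

lemma measurable_maximalFunction {n : ℕ} (Ω : Set (EuclideanSpace ℝ (Fin n)))
    (f : EuclideanSpace ℝ (Fin n) → ℝ) : Measurable (maximalFunction Ω f) := by
  refine measurable_of_Ioi fun t => IsOpen.measurableSet ?_
  change IsOpen {x | t < maximalFunction Ω f x}
  rw [setOf_lt_maximalFunction_eq]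
  exact isOpen_iUnion fun i => Metric.isOpen_ball

/-- The weak type estimate, with the small values of `f` discarded: on a ball where the average
of `|f|` exceeds `2 * s`, the part of `f` with values above `s` has average at least `s`. -/
lemma mul_volume_setOf_lt_maximalFunction_le {n : ℕ} {Ω : Set (EuclideanSpace ℝ (Fin n))}
    (hΩ : MeasurableSet Ω) (f : EuclideanSpace ℝ (Fin n) → ℝ) {s : ℝ≥0∞} (hs : s ≠ ∞) :
    s * volume {x | 2 * s < maximalFunction Ω f x}
      ≤ 5 ^ n * ∫⁻ y in Ω, {y | s < ‖f y‖ₑ}.indicator (fun y => ‖f y‖ₑ) y := by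
  rw [setOf_lt_maximalFunction_eq, ← lintegral_indicator hΩ]
  refine volume_iUnion_ball_le (fun i : {i : EuclideanSpace ℝ (Fin n) × ℝ // _} => i.1.1)
    (fun i => i.1.2) (fun i => i.2.1) fun i => ?_
  obtain ⟨⟨z, r⟩, hr, h⟩ := i
  simp only at hr h ⊢
  set v := volume (Metric.ball z r) with hv
  have hv0 : v ≠ 0 := (Metric.measure_ball_pos volume z hr).ne'
  have hvt : v ≠ ∞ := measure_ball_lt_top.ne
  have h1 : s * v + s * v ≤ ∫⁻ y in Metric.ball z r ∩ Ω, ‖f y‖ₑ := by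
    have := mul_le_mul_right h.le v
    rw [← mul_assoc v v⁻¹, ENNReal.mul_inv_cancel hv0 hvt, one_mul] at this
    exact le_trans (le_of_eq (by ring)) this
  have h2 : ∫⁻ y in Metric.ball z r ∩ Ω, ‖f y‖ₑ
      ≤ (∫⁻ y in Metric.ball z r ∩ Ω, {y | s < ‖f y‖ₑ}.indicator (fun y => ‖f y‖ₑ) y) + s * v := by
    calc ∫⁻ y in Metric.ball z r ∩ Ω, ‖f y‖ₑ
        ≤ ∫⁻ y in Metric.ball z r ∩ Ω, ({y | s < ‖f y‖ₑ}.indicator (fun y => ‖f y‖ₑ) y + s) := by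
          refine lintegral_mono fun y => ?_
          by_cases hy : s < ‖f y‖ₑ
          · rw [indicator_of_mem (show y ∈ {y | s < ‖f y‖ₑ} from hy)]
            exact le_self_add
          · exact (not_lt.1 hy).trans le_add_self
      _ ≤ _ := by
          rw [lintegral_add_right _ measurable_const, setLIntegral_const]
          gcongr
          exact measure_mono inter_subset_left
  rw [setLIntegral_indicator hΩ, Set.inter_comm Ω (Metric.ball z r)]
  exact (ENNReal.add_le_add_iff_right (ENNReal.mul_ne_top hs hvt)).1 (h1.trans h2)

/-- Dyadic layer-cake bound; it includes `y = ∞`, where every term is present. -/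
lemma le_one_add_tsum_indicator (y : ℝ≥0∞) :
    y ≤ 1 + ∑' k : ℕ, {y : ℝ≥0∞ | 2 ^ k < y}.indicator (fun _ => 2 ^ k) y := by
  have geom : ∀ m : ℕ, (1 : ℝ≥0∞) + ∑ k ∈ Finset.range m, 2 ^ k = 2 ^ m := fun m => by
    induction m with
    | zero => simp
    | succ m ih => rw [Finset.sum_range_succ, ← add_assoc, ih, pow_succ, mul_two]
  have low : ∀ m : ℕ, (∀ k < m, (2 : ℝ≥0∞) ^ k < y) →
      (2 : ℝ≥0∞) ^ m ≤ 1 + ∑' k : ℕ, {y : ℝ≥0∞ | 2 ^ k < y}.indicator (fun _ => 2 ^ k) y := by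
    intro m hm
    rw [← geom m]
    refine add_le_add_right (le_trans (le_of_eq ?_) (ENNReal.sum_le_tsum (Finset.range m))) _
    refine Finset.sum_congr rfl fun k hk => ?_
    rw [indicator_of_mem (show y ∈ {y : ℝ≥0∞ | 2 ^ k < y} from hm k (Finset.mem_range.1 hk))]
  by_cases h : ∃ m : ℕ, y ≤ 2 ^ m
  · classical
    exact (Nat.find_spec h).trans (low _ fun k hk => not_le.1 (Nat.find_min h hk))
  · push Not at h
    have hle : ∀ m : ℕ, (m : ℝ≥0∞) ≤ 2 ^ m := fun m => by exact_mod_cast Nat.lt_two_pow_self.le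
    exact le_top.trans (le_of_tendsto' ENNReal.tendsto_nat_nhds_top fun m =>
      (hle m).trans (low m fun k _ => h k))

/-- The number of `k` with `2 ^ k < 2 * |s|` is logarithmic in `|s|`. -/
lemma tsum_indicator_enorm_le (s : ℝ) :
    ∑' k : ℕ, {s : ℝ | (2 : ℝ≥0∞) ^ k / 2 < ‖s‖ₑ}.indicator (fun s => ‖s‖ₑ) s
      ≤ 4 * ENNReal.ofReal (zygmundYoung 1 |s|) := by
  rcases eq_or_ne s 0 with rfl | hs
  · simp
  have hs0 : 0 < |s| := abs_pos.2 hs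
  set N : ℕ := ⌈1 + 2 * Real.log (Real.exp 1 + |s|)⌉₊ with hN
  have hl1 := one_le_log_exp_add hs0.le
  have hout : ∀ k ∉ Finset.range N,
      {s : ℝ | (2 : ℝ≥0∞) ^ k / 2 < ‖s‖ₑ}.indicator (fun s => ‖s‖ₑ) s = 0 := by
    intro k hk
    refine indicator_of_notMem (fun hks => hk ?_) _
    rw [Finset.mem_range, hN, Nat.lt_ceil]
    have h1 : (2 : ℝ) ^ k / 2 < |s| := by
      have hks' : (2 : ℝ≥0∞) ^ k / 2 < ‖s‖ₑ := hks
      rw [Real.enorm_eq_ofReal_abs, ENNReal.lt_ofReal_iff_toReal_lt (by finiteness)] at hks'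
      simpa using hks'
    have h2 : (2 : ℝ) ^ k < 2 * |s| := by linarith
    have h3 := Real.log_lt_log (by positivity) h2
    rw [Real.log_pow, Real.log_mul two_ne_zero hs0.ne'] at h3
    have h4 : Real.log |s| ≤ Real.log (Real.exp 1 + |s|) :=
      Real.log_le_log hs0 (by linarith [Real.exp_pos 1])
    -- `1 / log 2 < 2` and `1 ≤ log (e + |s|)` give `k < 1 + 2 * log (e + |s|)`
    have h5 := Real.log_two_gt_d9
    by_contra! h6
    nlinarith
  rw [tsum_eq_sum hout]
  calc ∑ k ∈ Finset.range N, {s : ℝ | (2 : ℝ≥0∞) ^ k / 2 < ‖s‖ₑ}.indicator (fun s => ‖s‖ₑ) s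
      ≤ ∑ k ∈ Finset.range N, ‖s‖ₑ := Finset.sum_le_sum fun k _ => indicator_le_self _ _ _
    _ = ENNReal.ofReal (N * |s|) := by
        rw [Finset.sum_const, Finset.card_range, nsmul_eq_mul, Real.enorm_eq_ofReal_abs,
          ENNReal.ofReal_mul (by positivity), ENNReal.ofReal_natCast]
    _ ≤ ENNReal.ofReal (4 * zygmundYoung 1 |s|) := by
        refine ENNReal.ofReal_le_ofReal ?_
        have h7 : (N : ℝ) < 1 + 2 * Real.log (Real.exp 1 + |s|) + 1 :=
          Nat.ceil_lt_add_one (by linarith)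
        rw [zygmundYoung, Real.rpow_one]
        nlinarith
    _ = 4 * ENNReal.ofReal (zygmundYoung 1 |s|) := by
        rw [ENNReal.ofReal_mul (by norm_num)]
        norm_num

/-- The maximal function maps `L log L` to `L¹` on a set of finite measure. -/
lemma lintegral_maximalFunction_le {n : ℕ} {Ω : Set (EuclideanSpace ℝ (Fin n))}
    (hΩ : MeasurableSet Ω) {f : EuclideanSpace ℝ (Fin n) → ℝ}
    (hf : AEStronglyMeasurable f (volume.restrict Ω)) :
    ∫⁻ x in Ω, maximalFunction Ω f x
      ≤ volume Ω + 8 * 5 ^ n * ∫⁻ x in Ω, ENNReal.ofReal (zygmundYoung 1 |f x|) := by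
  have hM := measurable_maximalFunction Ω f
  have hS : ∀ k : ℕ, MeasurableSet {x | (2 : ℝ≥0∞) ^ k < maximalFunction Ω f x} := fun k =>
    measurableSet_lt measurable_const hM
  have hterm : ∀ k : ℕ, (2 : ℝ≥0∞) ^ k
      * volume.restrict Ω {x | (2 : ℝ≥0∞) ^ k < maximalFunction Ω f x}
      ≤ 2 * 5 ^ n * ∫⁻ y in Ω,
        {s : ℝ | (2 : ℝ≥0∞) ^ k / 2 < ‖s‖ₑ}.indicator (fun s => ‖s‖ₑ) (f y) := fun k => by
    have e : (2 : ℝ≥0∞) * (2 ^ k / 2) = 2 ^ k :=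
      ENNReal.mul_div_cancel two_ne_zero ENNReal.ofNat_ne_top
    have h := mul_volume_setOf_lt_maximalFunction_le hΩ f (s := 2 ^ k / 2) (by finiteness)
    rw [e] at h
    calc _ ≤ (2 : ℝ≥0∞) ^ k * volume {x | (2 : ℝ≥0∞) ^ k < maximalFunction Ω f x} := by
          gcongr
          exact Measure.restrict_le_self
      _ = 2 * (2 ^ k / 2 * volume {x | (2 : ℝ≥0∞) ^ k < maximalFunction Ω f x}) := by
          rw [← mul_assoc, e]
      _ ≤ _ := by
          rw [mul_assoc]
          exact mul_le_mul_right h 2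
  calc ∫⁻ x in Ω, maximalFunction Ω f x
      ≤ ∫⁻ x in Ω, (1 + ∑' k : ℕ, {x | (2 : ℝ≥0∞) ^ k < maximalFunction Ω f x}.indicator
          (fun _ => 2 ^ k) x) :=
        lintegral_mono fun x => le_one_add_tsum_indicator (maximalFunction Ω f x)
    _ = volume Ω + ∑' k : ℕ, 2 ^ k
          * volume.restrict Ω {x | (2 : ℝ≥0∞) ^ k < maximalFunction Ω f x} := by
        rw [lintegral_add_left measurable_const,
          lintegral_tsum fun k => (measurable_const.indicator (hS k)).aemeasurable]
        simp only [lintegral_indicator_const (hS _), setLIntegral_const, one_mul]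
    _ ≤ volume Ω + ∑' k : ℕ, 2 * 5 ^ n * ∫⁻ y in Ω,
          {s : ℝ | (2 : ℝ≥0∞) ^ k / 2 < ‖s‖ₑ}.indicator (fun s => ‖s‖ₑ) (f y) := by
        exact add_le_add_right (ENNReal.tsum_le_tsum hterm) _
    _ = volume Ω + 2 * 5 ^ n * ∫⁻ y in Ω, ∑' k : ℕ,
          {s : ℝ | (2 : ℝ≥0∞) ^ k / 2 < ‖s‖ₑ}.indicator (fun s => ‖s‖ₑ) (f y) := by
        rw [ENNReal.tsum_mul_left, lintegral_tsum fun k => ?_]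
        exact (measurable_enorm.indicator
          (measurableSet_lt measurable_const measurable_enorm)).comp_aemeasurable hf.aemeasurable
    _ ≤ volume Ω + 2 * 5 ^ n * ∫⁻ y in Ω, 4 * ENNReal.ofReal (zygmundYoung 1 |f y|) := by
        gcongr with y
        exact tsum_indicator_enorm_le (f y)
    _ = _ := by
        rw [lintegral_const_mul' _ _ ENNReal.ofNat_ne_top]
        ring

lemma maximalFunction_const_mul {n : ℕ} (Ω : Set (EuclideanSpace ℝ (Fin n)))
    (f : EuclideanSpace ℝ (Fin n) → ℝ) (c : ℝ) (x : EuclideanSpace ℝ (Fin n)) :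
    maximalFunction Ω (fun y => c * f y) x = ‖c‖ₑ * maximalFunction Ω f x := by
  simp only [maximalFunction, ENNReal.mul_iSup, enorm_mul,
    lintegral_const_mul' _ _ enorm_ne_top, mul_left_comm]

/-! ### The embedding and the bound for the maximal function -/

theorem mainTheorem5 {n : ℕ} (Ω : Set (EuclideanSpace ℝ (Fin n))) (hΩ : IsOpen Ω)
    (hΩfin : volume Ω < ∞) (p : EuclideanSpace ℝ (Fin n) → ℝ≥0∞) (hp : IsExponent Ω p)
    (hpb : exponentSup Ω p < ∞) (a b : ℝ) (ha : 0 < a)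
    (hdist : ∃ C : ℝ, 1 < C ∧ ∀ᶠ r : ℝ in 𝓝[>] 0,
      volume {x ∈ Ω | p x ≤ ENNReal.ofReal (lambdaFun r a b)} ≤ ENNReal.ofReal (C * r)) :
    (variableLebesgue Ω p ⊆ orliczSpace (zygmundYoung a) Ω ∧
      ∃ K : ℝ≥0, ∀ f ∈ variableLebesgue Ω p,
        orliczNorm (zygmundYoung a) Ω f ≤ K * variableNorm Ω p f) ∧
    (a = 1 → ∃ K : ℝ≥0, ∀ f ∈ variableLebesgue Ω p,
      ∫⁻ x in Ω, maximalFunction Ω f x ≤ K * variableNorm Ω p f) := by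
  obtain ⟨C, -, hC⟩ := hdist
  obtain ⟨A, B, hAB⟩ := exists_lintegral_zygmundYoung_le_variableModular hΩ hΩfin hp hpb ha hC
  refine ⟨⟨?_, 1 + A + B, ?_⟩, ?_⟩
  · rintro f ⟨hf, c, hc, hm⟩
    exact ⟨hf, c, hc, (hAB f c hc).trans_lt
      (ENNReal.add_lt_top.2 ⟨ENNReal.coe_lt_top, ENNReal.mul_lt_top ENNReal.coe_lt_top hm⟩)⟩
  · intro f _
    refine le_mul_variableNorm (by positivity) fun c hc hm => ?_
    rw [← ENNReal.ofReal_coe_nnreal, ← ENNReal.ofReal_mul (NNReal.coe_nonneg _)]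
    exact orliczNorm_le_ofReal (by positivity)
      (lintegral_zygmundYoung_div_le ha hc (hAB f c hc) hm)
  · rintro rfl
    refine ⟨1 + (volume Ω).toNNReal + 8 * 5 ^ n * (A + B), fun f hf => ?_⟩
    refine le_mul_variableNorm (by positivity) fun c hc hm => ?_
    have hscale : ∀ x, maximalFunction Ω f x
        = ENNReal.ofReal c * maximalFunction Ω (fun y => c⁻¹ * f y) x := fun x => by
      rw [← Real.enorm_of_nonneg hc.le, ← maximalFunction_const_mul]
      simp only [mul_inv_cancel_left₀ hc.ne']
    have habs : ∀ x, |c⁻¹ * f x| = |f x| / c := fun x => by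
      rw [abs_mul, abs_of_pos (inv_pos.2 hc), inv_mul_eq_div]
    have hmax := lintegral_maximalFunction_le hΩ.measurableSet (hf.1.const_mul c⁻¹)
    simp only [habs] at hmax
    simp only [hscale]
    rw [lintegral_const_mul' _ _ ENNReal.ofReal_ne_top, mul_comm]
    refine mul_le_mul_left (hmax.trans ?_) _
    calc volume Ω + 8 * 5 ^ n * ∫⁻ x in Ω, ENNReal.ofReal (zygmundYoung 1 (|f x| / c))
        ≤ volume Ω + 8 * 5 ^ n * (A + B * 1) := by
          gcongr
          exact (hAB f c hc).trans (by gcongr)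
      _ ≤ 1 + (volume Ω + 8 * 5 ^ n * (A + B * 1)) := le_add_self
      _ = _ := by
          push_cast
          rw [ENNReal.coe_toNNReal hΩfin.ne]
          ring
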